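/- **Theorem.** Let $0<\theta<1$, $\lambda>0$ and $\beta=1/m$ with an integer $m\ge 2$. Let $(Y_n)_{n\ge 0}$ be a strictly stationary process with $$Y_n=I_nY_{n-1}+\epsilon_n \quad (n\ge 1),$$ that is, $Y_n=\epsilon_n$ with probability $\theta$ and $Y_n=Y_{n-1}+\epsilon_n$ with probability $1-\theta$. Here $P(I_n=0)=\theta=1-P(I_n=1)$; the innovations $\epsilon_n$ are real-valued and identically distributed; the pairs $(I_n,\epsilon_n)$, $n\ge1$, are independent; and, for each $n$, $I_n$ is independent of $\epsilon_n$ and $(I_n,\epsilon_n)$ is independent of $(Y_0,\dots,Y_{n-1})$. Suppose that the marginals $Y_n$ are geometric tempered stable: $Y_n>0$ almost surely and $$\mathbb E[e^{-sY_n}]=\frac{1}{1+(s+\lambda)^\beta-\lambda^\beta},\qquad s\ge 0.$$ Then the innovations are geometric tempered stable with scale $\theta$: $\epsilon_n>0$ almost surely and $$\mathbb E[e^{-s\epsilon_n}]=\frac{1}{1+\theta\left((s+\lambda)^\beta-\lambda^\beta\right)},\qquad s\ge 0.$$ Moreover, the law of $\epsilon_n$ is absolutely continuous and concentrated on $(0,\infty)$,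 with the density, for $x>0$, $$f_\epsilon(x)=R(x)+\frac1\pi\int_0^\infty \frac{\theta e^{-x(y+\lambda)}y^{\beta}\sin(\pi\beta)}{1+2\theta\left(y^{\beta}\cos(\pi\beta)-\lambda^\beta\right)+\theta^2\left(y^{2\beta}-2\lambda^\beta y^\beta\cos(\pi\beta)+\lambda^{2\beta}\right)}\,dy ,$$ where the integral converges absolutely, $f_\epsilon(x)\ge 0$, and $$R(x)=\begin{cases}\dfrac{e^{(s_0-\lambda)x}}{\theta\beta s_0^{\beta-1}},\quad s_0=\left(\lambda^\beta-\tfrac1\theta\right)^{1/\beta}=\left(\lambda^\beta-\tfrac1\theta\right)^{m}, & \text{if }\lambda>\theta^{-m},\\[2mm] 0, & \text{if }\lambda\le\theta^{-m}.\end{cases}$$ -/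

import Mathlib

open MeasureTheory ProbabilityTheory Set

noncomputable section

/-- A stationary process `Y 0, Y 1, …` following, for `n ≥ 0`, the autoregressive scheme
`Y (n+1) = ε (n+1)` with probability `θ` and `Y (n+1) = Y n + ε (n+1)` with probability `1 - θ`.
The choice is made by a variable `I (n+1)` with values `0` and `1`.  The terms `ε n`, `n ≥ 1`, are
the innovations; `ε 0` and `I 0` play no role. -/
structure IsStationaryAR {Ω : Type*} [MeasurableSpace Ω] (μ : Measure Ω) (θ : ℝ)
    (Y I ε : ℕ → Ω → ℝ) : Prop where
  measurable_Y : ∀ n, Measurable (Y n)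
  measurable_I : ∀ n, Measurable (I (n + 1))
  measurable_ε : ∀ n, Measurable (ε (n + 1))
  /-- the switching variable vanishes with probability `θ` -/
  prob_zero : ∀ n, μ.real {ω | I (n + 1) ω = 0} = θ
  /-- the switching variable is one with probability `1 - θ` -/
  prob_one : ∀ n, μ.real {ω | I (n + 1) ω = 1} = 1 - θ
  /-- the innovations are identically distributed -/
  identDistrib_ε : ∀ n, IdentDistrib (ε (n + 1)) (ε 1) μ μ
  /-- the pairs of switching variable and innovation are independent over time -/
  indep_time : iIndepFun (fun (n : ℕ) ω => (I (n + 1) ω, ε (n + 1) ω)) μ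
  /-- the switching variable is independent of the innovation of the same time -/
  indep_switch : ∀ n, IndepFun (I (n + 1)) (ε (n + 1)) μ
  /-- switching variable and innovation are independent of the past of the process -/
  indep_past : ∀ n, IndepFun (fun ω => (I (n + 1) ω, ε (n + 1) ω))
    (fun ω (k : Fin (n + 1)) => Y k ω) μ
  recurrence : ∀ n, ∀ᵐ ω ∂μ, Y (n + 1) ω = I (n + 1) ω * Y n ω + ε (n + 1) ω
  /-- strict stationarity -/
  stationary : ∀ k, IdentDistrib (fun ω (n : ℕ) => Y (n + k) ω) (fun ω (n : ℕ) => Y n ω) μ μ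

/-- `ν` is the geometric tempered stable law on `(0, ∞)` with scale `c` and parameters `β`, `l`:
its Laplace transform is `s ↦ 1 / (1 + c ((s + l) ^ β - l ^ β))`. -/
def IsGeometricTemperedStable (ν : Measure ℝ) (c β l : ℝ) : Prop :=
  ν (Iic 0) = 0 ∧
    ∀ s : ℝ, 0 ≤ s → ∫ x, Real.exp (-(s * x)) ∂ν = 1 / (1 + c * ((s + l) ^ β - l ^ β))

/-- The integrand `y ↦ …` of the density of the innovations at the point `x`. -/
def innovationIntegrand (θ β l x y : ℝ) : ℝ :=
  θ * Real.exp (-(x * (y + l))) * y ^ β * Real.sin (Real.pi * β) /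
    (1 + 2 * θ * (y ^ β * Real.cos (Real.pi * β) - l ^ β) +
      θ ^ 2 * (y ^ (2 * β) - 2 * l ^ β * y ^ β * Real.cos (Real.pi * β) + l ^ (2 * β)))

/-- The location `(l ^ β - 1 / θ) ^ (1 / β)`, where `β = 1 / m`, of the pole. -/
def innovationPole (θ : ℝ) (m : ℕ) (l : ℝ) : ℝ :=
  (l ^ (1 / (m : ℝ)) - 1 / θ) ^ m

/-- The contribution of the pole to the density, which is there only if `l > 1 / θ ^ m`. -/
def innovationResidue (θ : ℝ) (m : ℕ) (l x : ℝ) : ℝ :=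
  if 1 / θ ^ m < l then
    Real.exp ((innovationPole θ m l - l) * x) /
      (θ * (1 / (m : ℝ)) * innovationPole θ m l ^ (1 / (m : ℝ) - 1))
  else 0

/-- The density of the innovations at `x > 0`, for `β = 1 / m`. -/
def innovationDensity (θ : ℝ) (m : ℕ) (l x : ℝ) : ℝ :=
  innovationResidue θ m l x +
    1 / Real.pi * ∫ y in Ioi (0 : ℝ), innovationIntegrand θ (1 / (m : ℝ)) l x y

end

/-!
Write `φ_Y` and `φ_ε` for the Laplace transforms of the marginals and of the innovations. Splitting
the recurrence according to the value of the switching variable gives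
`φ_Y = θ φ_ε + (1 - θ) φ_ε φ_Y` (`IsStationaryAR.lintegral_exp_recurrence`), and solving for `φ_ε`
yields `1 / (1 + θ ((s + l) ^ β - l ^ β))`. Positivity of the innovations holds because
`Y (n + 1) = ε (n + 1)` on an independent event of probability `θ > 0`.

For the density put `r = l ^ β - 1 / θ` and `q = (s + l) ^ β`, so that `φ_ε (s) = 1 / (θ (q - r))`
and `s + l = q ^ m`. The integral in the density is
`∫ K(y) e ^ (-x (y + l)) dy` with a nonnegative `K`, so by Tonelli its Laplace transform is the
Stieltjes transform `∫ K(y) / (y + q ^ m) dy`. The substitution `y = t ^ m` makes it the integral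
of a rational function of `t`, namely of the imaginary part of
`m z ^ (m - 1) / ((z - r) (z ^ m - q ^ m))` along the ray `arg z = π / m` (up to sign).
Since `m z ^ (m - 1) / (z ^ m - q ^ m)` is the sum of `1 / (z - c)` over the `m`-th roots `c` of
`q ^ m`, partial fractions give an explicit antiderivative in terms of principal logarithms. The
real parts of the logarithms cancel, and conjugation symmetry of the roots reduces the arguments to
`π / (q - r)`, minus a contribution of the pole `r` that is present only if `r > 0`
(`integral_sector`). The term `innovationResidue` compensates exactly for the latter
(`lintegral_exp_mul_innovationDensity`).

The partial fractions require `q ≠ |r|`; it suffices to take `s` large, where `q > |r|`, because a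
measure on `(0, ∞)` is determined by its Laplace transform on a half-line. After an exponential
tilt and the substitution `u = e ^ (-x)` this is the uniqueness in the Hausdorff moment problem
(`ext_of_lintegral_exp_neg`).
-/

/-! ### A rational integral along the sides of a sector -/

theorem sum_one_div_sub_rootsOfUnity {m : ℕ} (hm : 0 < m) {ζ : ℂ} (hζ : IsPrimitiveRoot ζ m)
    (α z : ℂ) (hz : z ^ m ≠ α ^ m) :
    ∑ i ∈ Finset.range m, 1 / (z - ζ ^ i * α) = m * z ^ (m - 1) / (z ^ m - α ^ m) := by
  -- the sum is the logarithmic derivative of `∏ (w - ζ ^ i * α)`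
  have hprod : ∀ w : ℂ, w ^ m - α ^ m = ∏ i ∈ Finset.range m, (w - ζ ^ i * α) := by
    intro w
    have := congrArg (Polynomial.eval w) (X_pow_sub_C_eq_prod hζ hm (rfl : α ^ m = α ^ m))
    simpa [Polynomial.eval_prod] using this
  have hne : ∀ i ∈ Finset.range m, z - ζ ^ i * α ≠ 0 := by
    have h := sub_ne_zero.2 hz
    rw [hprod z] at h
    exact Finset.prod_ne_zero_iff.1 h
  have h1 : logDeriv (fun w : ℂ => w ^ m - α ^ m) z
      = ∑ i ∈ Finset.range m, logDeriv (fun w : ℂ => w - ζ ^ i * α) z := by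
    rw [funext hprod]
    exact logDeriv_prod hne (fun i _ => by fun_prop)
  simp only [logDeriv_apply, deriv_sub_const, deriv_pow_field, deriv_id''] at h1
  rw [← h1]

theorem add_mem_slitPlane {u : ℂ} (hu : u ∈ Complex.slitPlane) {t : ℝ} (ht : 0 ≤ t) :
    (t : ℂ) + u ∈ Complex.slitPlane := by
  rw [Complex.mem_slitPlane_iff] at hu ⊢
  rcases hu with hu | hu
  · left; simp; linarith
  · right; simpa using hu

theorem exp_mul_I_mem_slitPlane {x : ℝ} (h1 : -Real.pi < x) (h2 : x < Real.pi) {r : ℝ}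
    (hr : 0 < r) : (r : ℂ) * Complex.exp (x * Complex.I) ∈ Complex.slitPlane := by
  rw [Complex.mem_slitPlane_iff_arg]
  refine ⟨?_, by simp [hr.ne']⟩
  rw [Complex.arg_real_mul _ hr, Complex.arg_exp_mul_I,
    (toIocMod_eq_self Real.two_pi_pos).2 ⟨h1, by linarith⟩]
  exact h2.ne

theorem log_mul_exp_mul_I {x : ℝ} (h1 : -Real.pi < x) (h2 : x < Real.pi) {r : ℝ}
    (hr : 0 < r) :
    Complex.log ((r : ℂ) * Complex.exp (x * Complex.I)) = Real.log r + x * Complex.I := by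
  rw [Complex.log_ofReal_mul hr (Complex.exp_ne_zero _), Complex.log_exp] <;> simp <;> linarith

theorem tendsto_log_add_sub_log (u : ℂ) :
    Filter.Tendsto (fun t : ℝ => Complex.log (t + u) - Complex.log t) Filter.atTop (nhds 0) := by
  have h0 : Filter.Tendsto (fun t : ℝ => ((t⁻¹ : ℝ) : ℂ)) Filter.atTop (nhds ((0 : ℝ) : ℂ)) :=
    (Complex.continuous_ofReal.tendsto 0).comp tendsto_inv_atTop_zero
  have h2 : Filter.Tendsto (fun t : ℝ => 1 + u * ((t⁻¹ : ℝ) : ℂ)) Filter.atTop (nhds 1) := by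
    simpa using (h0.const_mul u).const_add 1
  have h1 := (continuousAt_clog (x := 1) (by simp)).tendsto.comp h2
  rw [Complex.log_one] at h1
  refine h1.congr' ?_
  filter_upwards [Filter.eventually_gt_atTop 0, Filter.eventually_gt_atTop (‖u‖)] with t ht htu
  have htc : (t : ℂ) ≠ 0 := by exact_mod_cast ht.ne'
  have hne : 1 + u * ((t⁻¹ : ℝ) : ℂ) ≠ 0 := by
    intro h
    have h3 : u = -t := by
      push_cast at h
      field_simp at h
      linear_combination h
    rw [h3] at htu
    simp [abs_of_pos ht] at htu
  have h4 : (t : ℂ) + u = (t : ℂ) * (1 + u * ((t⁻¹ : ℝ) : ℂ)) := by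
    push_cast; field_simp
  rw [Function.comp_apply, h4, Complex.log_ofReal_mul ht hne, Complex.ofReal_log ht.le]
  ring

/-- The `m`-th roots of `q ^ m` with angles `2 π j / m`, `1 ≤ j ≤ m`, are symmetric under `j ↦ m - j`,
which changes the sign of the weight `2 π j / m - π`; only the root `q` itself contributes. -/
theorem sum_angle_mul_re {m : ℕ} (hm : 2 ≤ m) (q r : ℝ) :
    ∑ j ∈ Finset.range m, (2 * (Real.pi / m) * (j + 1) - Real.pi) *
      (1 / ((q : ℂ) * Complex.exp (((2 * (Real.pi / m) * (j + 1) : ℝ) : ℂ) * Complex.I) - r)).re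
      = Real.pi / (q - r) := by
  obtain ⟨n, rfl⟩ : ∃ n, m = n + 1 := ⟨m - 1, by omega⟩
  have hn : ((n : ℝ) + 1) ≠ 0 := by positivity
  rw [Finset.sum_range_succ]
  set F : ℕ → ℝ := fun j => (2 * (Real.pi / (n + 1 : ℕ)) * (j + 1) - Real.pi) *
      (1 / ((q : ℂ) * Complex.exp (((2 * (Real.pi / (n + 1 : ℕ)) * (j + 1) : ℝ) : ℂ) * Complex.I)
        - r)).re with hF
  -- the index `j` stands for the root number `j + 1`, so the symmetry is `j ↦ n - 1 - j`
  have hanti : ∑ j ∈ Finset.range n, F j = 0 := by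
    have h1 := Finset.sum_range_reflect F n
    have h2 : ∑ j ∈ Finset.range n, F (n - 1 - j) = ∑ j ∈ Finset.range n, - F j := by
      refine Finset.sum_congr rfl fun j hj => ?_
      rw [Finset.mem_range] at hj
      have hc : ((n - 1 - j : ℕ) : ℝ) = n - 1 - j := by
        rw [Nat.cast_sub (by omega), Nat.cast_sub (by omega)]; simp
      have ha : 2 * (Real.pi / (n + 1 : ℕ)) * (((n - 1 - j : ℕ) : ℝ) + 1)
          = 2 * Real.pi - 2 * (Real.pi / (n + 1 : ℕ)) * (j + 1) := by
        rw [hc]; push_cast; field_simp; ring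
      simp only [hF]
      rw [ha]
      generalize 2 * (Real.pi / (n + 1 : ℕ)) * ((j : ℝ) + 1) = α
      have : (1 / ((q : ℂ) * Complex.exp (((2 * Real.pi - α : ℝ) : ℂ) * Complex.I) - r)).re
          = (1 / ((q : ℂ) * Complex.exp ((α : ℂ) * Complex.I) - r)).re := by
        have hs : (q : ℂ) * Complex.exp (((2 * Real.pi - α : ℝ) : ℂ) * Complex.I) - r
            = (starRingEnd ℂ) ((q : ℂ) * Complex.exp ((α : ℂ) * Complex.I) - r) := by
          simp only [map_sub, map_mul, Complex.conj_ofReal, ← Complex.exp_conj, Complex.conj_I]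
          congr 2
          push_cast
          rw [sub_mul, Complex.exp_sub, Complex.exp_two_pi_mul_I, mul_neg, Complex.exp_neg, one_div]
        rw [hs, one_div, ← map_inv₀, Complex.conj_re, one_div]
      rw [this]; ring
    rw [h2, Finset.sum_neg_distrib] at h1
    linarith
  rw [hanti]
  have h3 : 2 * (Real.pi / (n + 1 : ℕ)) * ((n : ℝ) + 1) = 2 * Real.pi := by
    push_cast; field_simp
  rw [h3]
  have h4 : Complex.exp (((2 * Real.pi : ℝ) : ℂ) * Complex.I) = 1 := by
    push_cast; exact Complex.exp_two_pi_mul_I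
  rw [h4]
  have h5 : (1 / ((q : ℂ) * 1 - r)) = ((1 / (q - r) : ℝ) : ℂ) := by push_cast; ring
  rw [h5, Complex.ofReal_re]
  ring

/-- The imaginary part of `∫ m z ^ (m - 1) / ((z - r) (z ^ m - q ^ m)) dz` along the ray
`arg z = π / m`, up to sign. On that ray `z = t e ^ (i π / m)` and `z ^ m = - t ^ m`. -/
theorem integral_sector {m : ℕ} (hm : 2 ≤ m) {q r : ℝ} (hrq : |r| < q) :
    IntegrableOn (fun t : ℝ => m * t ^ m * Real.sin (Real.pi / m) /
      ((t ^ 2 - 2 * r * t * Real.cos (Real.pi / m) + r ^ 2) * (t ^ m + q ^ m))) (Ioi 0) ∧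
    ∫ t in Ioi (0 : ℝ), m * t ^ m * Real.sin (Real.pi / m) /
      ((t ^ 2 - 2 * r * t * Real.cos (Real.pi / m) + r ^ 2) * (t ^ m + q ^ m)) =
      Real.pi / (q - r) - if 0 < r then Real.pi * (m * r ^ (m - 1) / (q ^ m - r ^ m)) else 0 := by
  have hm0 : (0 : ℝ) < m := by positivity
  have hq : 0 < q := (abs_nonneg r).trans_lt hrq
  obtain ⟨hr1, hr2⟩ := abs_lt.1 hrq
  set φ : ℝ := Real.pi / m with hφ
  have hφm : φ * m = Real.pi := by rw [hφ]; field_simp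
  have hφ0 : 0 < φ := by positivity
  have hφ1 : φ < Real.pi := by
    have : (2 : ℝ) ≤ m := by exact_mod_cast hm
    nlinarith
  have hsin : 0 < Real.sin φ := Real.sin_pos_of_pos_of_lt_pi hφ0 hφ1
  set e : ℂ := Complex.exp (φ * Complex.I) with he
  have he0 : e ≠ 0 := Complex.exp_ne_zero _
  have hem : e ^ m = -1 := by
    rw [he, ← Complex.exp_nat_mul, ← Complex.exp_pi_mul_I, ← hφm]
    congr 1; push_cast; ring
  -- `c j` are the roots of `q ^ m`, `w j` the coefficients of the partial fractions; `u j` and `v`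
  -- are `- c j / e` and `- r / e`, written with an argument between `-π` and `π`
  set c : ℕ → ℂ := fun j => (q : ℂ) * Complex.exp (((2 * φ * (j + 1) : ℝ) : ℂ) * Complex.I) with hc
  set w : ℕ → ℂ := fun j => 1 / (c j - r) with hw
  set u : ℕ → ℂ := fun j =>
    (q : ℂ) * Complex.exp (((φ * (2 * j + 1) - Real.pi : ℝ) : ℂ) * Complex.I) with hu
  set ρ : ℝ := if 0 < r then Real.pi - φ else - φ with hρ
  set v : ℂ := ((|r| : ℝ) : ℂ) * Complex.exp ((ρ : ℂ) * Complex.I) with hv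
  have hrpow : |r| ^ m < q ^ m := pow_lt_pow_left₀ hrq (abs_nonneg r) (by omega)
  have hrm : r ^ m < q ^ m := (le_abs_self _).trans_lt (by rwa [abs_pow])
  have hue : ∀ j, u j * e = - c j := by
    intro j
    simp only [hu, hc, he]
    rw [mul_assoc, ← Complex.exp_add, ← mul_neg, ← neg_one_mul, ← Complex.exp_pi_mul_I,
      ← Complex.exp_add]
    congr 1
    rw [Complex.exp_eq_exp_iff_exists_int]
    exact ⟨-1, by push_cast; ring⟩
  have hve : v * e = - r := by
    simp only [hv, he]
    rw [mul_assoc, ← Complex.exp_add]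
    by_cases h : 0 < r
    · rw [hρ, if_pos h, abs_of_pos h]
      have : ((Real.pi - φ : ℝ) : ℂ) * Complex.I + φ * Complex.I = Real.pi * Complex.I := by
        push_cast; ring
      rw [this, Complex.exp_pi_mul_I]; ring
    · rw [hρ, if_neg h, abs_of_nonpos (not_lt.1 h)]
      have : ((- φ : ℝ) : ℂ) * Complex.I + φ * Complex.I = 0 := by
        push_cast; ring
      rw [this, Complex.exp_zero]; push_cast; ring
  have hsum : ∀ z : ℂ, z ^ m ≠ (q : ℂ) ^ m →
      ∑ j ∈ Finset.range m, 1 / (z - c j) = m * z ^ (m - 1) / (z ^ m - (q : ℂ) ^ m) := by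
    intro z hz
    have hζ := Complex.isPrimitiveRoot_exp m (by omega)
    set ζ := Complex.exp (2 * Real.pi * Complex.I / m) with hζd
    have h1 : ∀ j, c j = ζ ^ j * (ζ * q) := by
      intro j
      rw [hζd, ← Complex.exp_nat_mul, ← mul_assoc, ← Complex.exp_add, mul_comm]
      simp only [hc, hφ]
      congr 2
      push_cast; ring
    have h2 : (ζ * (q : ℂ)) ^ m = (q : ℂ) ^ m := by rw [mul_pow, hζ.pow_eq_one, one_mul]
    simp only [h1]
    rw [sum_one_div_sub_rootsOfUnity (by omega) hζ _ _ (by rwa [h2]), h2]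
  have hcr : ∀ j, c j - r ≠ 0 := by
    intro j h
    have h1 : ‖c j‖ = ‖(r : ℂ)‖ := by rw [sub_eq_zero.1 h]
    simp only [hc, norm_mul, Complex.norm_exp_ofReal_mul_I, Complex.norm_real, mul_one,
      Real.norm_eq_abs, abs_of_pos hq] at h1
    linarith
  have hW : ∑ j ∈ Finset.range m, w j = ((m * r ^ (m - 1) / (q ^ m - r ^ m) : ℝ) : ℂ) := by
    have h1 := hsum r (by exact_mod_cast hrm.ne)
    have h2 : ∀ j, w j = - (1 / ((r : ℂ) - c j)) := by
      intro j; rw [hw, ← one_div_neg_eq_neg_one_div, neg_sub]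
    simp only [h2, Finset.sum_neg_distrib]
    rw [h1]
    push_cast
    rw [← neg_sub ((r : ℂ) ^ m), div_neg]
  set W : ℝ := m * r ^ (m - 1) / (q ^ m - r ^ m) with hWd
  have hang : ∀ j ∈ Finset.range m, -Real.pi < φ * (2 * j + 1) - Real.pi ∧
      φ * (2 * j + 1) - Real.pi < Real.pi := by
    intro j hj
    rw [Finset.mem_range] at hj
    have : (j : ℝ) + 1 ≤ m := by exact_mod_cast hj
    constructor
    · have : 0 < φ * (2 * j + 1) := by positivity
      linarith
    · nlinarith
  have hρ1 : -Real.pi < ρ := by rw [hρ]; split_ifs <;> linarith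
  have hρ2 : ρ < Real.pi := by rw [hρ]; split_ifs <;> linarith
  have hus : ∀ j ∈ Finset.range m, u j ∈ Complex.slitPlane := fun j hj =>
    exp_mul_I_mem_slitPlane (hang j hj).1 (hang j hj).2 hq
  have hvs : ∀ t : ℝ, 0 < t → (t : ℂ) + v ∈ Complex.slitPlane := by
    intro t ht
    rcases eq_or_ne r 0 with h | h
    · simp [hv, h, ht]
    · exact add_mem_slitPlane (exp_mul_I_mem_slitPlane hρ1 hρ2 (abs_pos.2 h)) ht.le
  -- for `r = 0` the logarithm at `v = 0` is singular, but its coefficient vanishes as `2 ≤ m`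
  have hW0 : r = 0 → W = 0 := by
    intro h
    rw [hWd, h, zero_pow (by omega)]; simp
  -- the antiderivative of the integrand is `- Im L`
  set L : ℝ → ℂ := fun t => ∑ j ∈ Finset.range m, w j * Complex.log (t + u j)
    - W * Complex.log (t + v) with hL
  have hcont : ContinuousWithinAt (fun t => -(L t).im) (Ici 0) 0 := by
    apply ContinuousAt.continuousWithinAt
    refine (Complex.continuous_im.continuousAt.comp ?_).neg
    refine ContinuousAt.sub ?_ ?_
    · refine tendsto_finsetSum _ fun j hj => ?_
      refine ContinuousAt.mul continuousAt_const ?_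
      refine ContinuousAt.clog (by fun_prop) (add_mem_slitPlane (hus j hj) le_rfl)
    · rcases eq_or_ne r 0 with h | h
      · simp [hW0 h, continuousAt_const]
      · exact continuousAt_const.mul (ContinuousAt.clog (by fun_prop)
          (add_mem_slitPlane (exp_mul_I_mem_slitPlane hρ1 hρ2 (abs_pos.2 h)) le_rfl))
  have hlim : Filter.Tendsto (fun t => -(L t).im) Filter.atTop (nhds 0) := by
    -- the coefficients of the logarithms add up to zero, so `log t` may be subtracted from each
    have h1 : Filter.Tendsto L Filter.atTop (nhds 0) := by
      have h2 : L = fun t : ℝ =>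
          ∑ j ∈ Finset.range m, w j * (Complex.log (t + u j) - Complex.log t)
          - W * (Complex.log (t + v) - Complex.log t) := by
        funext t
        simp only [hL, mul_sub, Finset.sum_sub_distrib]
        rw [← Finset.sum_mul, hW]
        ring
      rw [h2]
      have h3 := (tendsto_finsetSum (Finset.range m) (fun j _ =>
        (tendsto_log_add_sub_log (u j)).const_mul (w j))).sub
          ((tendsto_log_add_sub_log v).const_mul (W : ℂ))
      simpa using h3
    have := ((Complex.continuous_im.tendsto 0).comp h1).neg
    simpa using this
  have hden : ∀ t : ℝ, 0 < t → 0 < t ^ 2 - 2 * r * t * Real.cos φ + r ^ 2 := by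
    intro t ht
    have h1 : t ^ 2 - 2 * r * t * Real.cos φ + r ^ 2 =
        (r - t * Real.cos φ) ^ 2 + (t * Real.sin φ) ^ 2 := by
      linear_combination (- t ^ 2) * (Real.sin_sq_add_cos_sq φ)
    rw [h1]
    positivity
  have hder : ∀ t ∈ Ioi (0 : ℝ), HasDerivAt (fun t => -(L t).im)
      (m * t ^ m * Real.sin φ / ((t ^ 2 - 2 * r * t * Real.cos φ + r ^ 2) * (t ^ m + q ^ m))) t := by
    intro t ht
    rw [mem_Ioi] at ht
    have hlog : ∀ x : ℂ, (t : ℂ) + x ∈ Complex.slitPlane →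
        HasDerivAt (fun s : ℝ => Complex.log (s + x)) (1 / (t + x)) t := by
      intro x hx
      exact ((Complex.ofRealCLM.hasDerivAt (x := t)).add_const x).clog_real hx
    have h1 : HasDerivAt L (∑ j ∈ Finset.range m, w j * (1 / (t + u j)) - W * (1 / (t + v))) t := by
      refine HasDerivAt.sub ?_ ((hlog v (hvs t ht)).const_mul _)
      exact HasDerivAt.fun_sum fun j hj =>
        (hlog (u j) (add_mem_slitPlane (hus j hj) ht.le)).const_mul _
    set z : ℂ := t * e with hz
    have hzm : z ^ m = - (t : ℂ) ^ m := by rw [hz, mul_pow, hem]; ring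
    have hzq : z ^ m ≠ (q : ℂ) ^ m := by
      rw [hzm]
      have : -t ^ m ≠ q ^ m := by have := pow_pos ht m; have := pow_pos hq m; linarith
      exact_mod_cast this
    have hzv : z - r = e * (t + v) := by rw [hz]; linear_combination -hve
    have hzu : ∀ j, z - c j = e * (t + u j) := by intro j; rw [hz]; linear_combination -(hue j)
    have hzr : z - r ≠ 0 := by
      rw [hzv]; exact mul_ne_zero he0 (Complex.slitPlane_ne_zero (hvs t ht))
    have h2 : ∑ j ∈ Finset.range m, w j * (1 / (t + u j)) - W * (1 / (t + v))
        = e / (z - r) * (m * z ^ (m - 1) / (z ^ m - (q : ℂ) ^ m)) := by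
      rw [← hsum z hzq, ← hW, Finset.sum_mul, ← Finset.sum_sub_distrib, Finset.mul_sum]
      refine Finset.sum_congr rfl fun j hj => ?_
      have h3 : (t : ℂ) + u j ≠ 0 :=
        Complex.slitPlane_ne_zero (add_mem_slitPlane (hus j hj) ht.le)
      have h4 : (t : ℂ) + v ≠ 0 := Complex.slitPlane_ne_zero (hvs t ht)
      have h5 := hcr j
      have h6 : c j - r = e * (v - u j) := by linear_combination hue j - hve
      simp only [hw]
      rw [hzv, hzu]
      rw [h6] at h5 ⊢
      have h7 : v - u j ≠ 0 := right_ne_zero_of_mul h5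
      field_simp
      ring
    have h3 : e / (z - r) * (m * z ^ (m - 1) / (z ^ m - (q : ℂ) ^ m))
        = ((m * t ^ (m - 1) / (t ^ m + q ^ m) : ℝ) : ℂ) * (z - r)⁻¹ := by
      have h4 : e * z ^ (m - 1) = - (t : ℂ) ^ (m - 1) := by
        rw [hz, mul_pow]
        have : e * e ^ (m - 1) = -1 := by rw [← pow_succ', Nat.sub_add_cancel (by omega), hem]
        linear_combination (t : ℂ) ^ (m - 1) * this
      have h5 : -(t : ℂ) ^ m - (q : ℂ) ^ m ≠ 0 := by rw [← hzm]; exact sub_ne_zero.2 hzq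
      have h6 : (t : ℂ) ^ m + (q : ℂ) ^ m ≠ 0 := fun h => h5 (by linear_combination -h)
      rw [hzm]
      push_cast
      rw [show -(t : ℂ) ^ m - (q : ℂ) ^ m = -((t : ℂ) ^ m + (q : ℂ) ^ m) by ring]
      field_simp
      linear_combination (-m : ℂ) * h4
    rw [h2, h3] at h1
    have h4 := (Complex.imCLM.hasFDerivAt.comp_hasDerivAt t h1).neg
    refine h4.congr_deriv ?_
    have hzre : (z - r).re = t * Real.cos φ - r := by
      simp [hz, he, Complex.exp_ofReal_mul_I_re]
    have hzim : (z - r).im = t * Real.sin φ := by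
      simp [hz, he, Complex.exp_ofReal_mul_I_im]
    have hnsq : Complex.normSq (z - r) = t ^ 2 - 2 * r * t * Real.cos φ + r ^ 2 := by
      rw [Complex.normSq_apply, hzre, hzim]
      linear_combination t ^ 2 * Real.sin_sq_add_cos_sq φ
    have htm : t ^ m = t ^ (m - 1) * t := by rw [← pow_succ, Nat.sub_add_cancel (by omega)]
    rw [Complex.imCLM_apply, Complex.im_ofReal_mul, Complex.inv_im, hzim, hnsq]
    have h5 := (hden t ht).ne'
    have h6 : t ^ m + q ^ m ≠ 0 := by positivity
    field_simp
    rw [htm]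
  have hnonneg : ∀ t ∈ Ioi (0 : ℝ), 0 ≤ m * t ^ m * Real.sin φ /
      ((t ^ 2 - 2 * r * t * Real.cos φ + r ^ 2) * (t ^ m + q ^ m)) := by
    intro t ht
    rw [mem_Ioi] at ht
    have := hden t ht
    positivity
  refine ⟨integrableOn_Ioi_deriv_of_nonneg hcont hder hnonneg hlim, ?_⟩
  rw [integral_Ioi_of_hasDerivAt_of_nonneg hcont hder hnonneg hlim]
  -- the value at `0` is a weighted sum of the arguments of the `u j` and of `v`
  have hval : (L 0).im = ∑ j ∈ Finset.range m,
      ((w j).re * (φ * (2 * j + 1) - Real.pi) + (w j).im * Real.log q) - W * ρ := by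
    simp only [hL, Complex.sub_im, Complex.im_sum, Complex.ofReal_zero, zero_add]
    congr 1
    · refine Finset.sum_congr rfl fun j hj => ?_
      rw [hu, log_mul_exp_mul_I (hang j hj).1 (hang j hj).2 hq, Complex.mul_im]
      simp
    · rw [Complex.im_ofReal_mul]
      rcases eq_or_ne r 0 with h | h
      · simp [hW0 h]
      · rw [hv, log_mul_exp_mul_I hρ1 hρ2 (abs_pos.2 h)]
        simp
  have hWre : ∑ j ∈ Finset.range m, (w j).re = W := by
    rw [← Complex.re_sum, hW, Complex.ofReal_re]
  have hWim : ∑ j ∈ Finset.range m, (w j).im = 0 := by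
    rw [← Complex.im_sum, hW, Complex.ofReal_im]
  have hangle := sum_angle_mul_re hm q r
  rw [← hφ] at hangle
  have h7 : ∑ j ∈ Finset.range m,
      ((w j).re * (φ * (2 * j + 1) - Real.pi) + (w j).im * Real.log q)
      = Real.pi / (q - r) - φ * W := by
    rw [Finset.sum_add_distrib, ← Finset.sum_mul, hWim, zero_mul, add_zero, ← hangle, ← hWre,
      Finset.mul_sum, ← Finset.sum_sub_distrib]
    refine Finset.sum_congr rfl fun j _ => ?_
    simp only [hw, hc]
    ring
  rw [hval, h7, hρ]
  split_ifs <;> ring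

/-! ### The Laplace transform of the density -/

/-- The function `K` for which the integrand of the density is `K y * exp (-(x * (y + l)))`, where
`β = 1 / m` and `r = l ^ β - 1 / θ`. -/
noncomputable def innovationSpectralDensity (θ : ℝ) (m : ℕ) (r y : ℝ) : ℝ :=
  y ^ (1 / (m : ℝ)) * Real.sin (Real.pi / m) /
    (θ * ((y ^ (1 / (m : ℝ))) ^ 2 - 2 * r * y ^ (1 / (m : ℝ)) * Real.cos (Real.pi / m) + r ^ 2))

theorem measurable_innovationSpectralDensity (θ : ℝ) (m : ℕ) (r : ℝ) :
    Measurable (innovationSpectralDensity θ m r) := by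
  unfold innovationSpectralDensity
  fun_prop

theorem innovationIntegrand_eq {θ : ℝ} (hθ : 0 < θ) (m : ℕ) {l : ℝ} (hl : 0 < l) (x : ℝ) {y : ℝ}
    (hy : 0 < y) :
    innovationIntegrand θ (1 / (m : ℝ)) l x y =
      innovationSpectralDensity θ m (l ^ (1 / (m : ℝ)) - 1 / θ) y * Real.exp (-(x * (y + l))) := by
  unfold innovationIntegrand innovationSpectralDensity
  have h1 : ∀ z : ℝ, 0 < z → z ^ (2 * (1 / (m : ℝ))) = (z ^ (1 / (m : ℝ))) ^ 2 := fun z hz => by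
    rw [mul_comm, Real.rpow_mul hz.le, Real.rpow_two]
  rw [h1 y hy, h1 l hl, mul_one_div Real.pi]
  generalize y ^ (1 / (m : ℝ)) = T
  generalize l ^ (1 / (m : ℝ)) = B
  have h2 : 1 + 2 * θ * (T * Real.cos (Real.pi / m) - B) +
      θ ^ 2 * (T ^ 2 - 2 * B * T * Real.cos (Real.pi / m) + B ^ 2)
      = θ * (θ * (T ^ 2 - 2 * (B - 1 / θ) * T * Real.cos (Real.pi / m) + (B - 1 / θ) ^ 2)) := by
    field_simp
    ring
  rw [h2, mul_assoc θ, mul_assoc θ, mul_div_mul_left _ _ hθ.ne']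
  ring

theorem sin_pi_div_pos {m : ℕ} (hm : 2 ≤ m) : 0 < Real.sin (Real.pi / m) := by
  have hm' : (2 : ℝ) ≤ m := by exact_mod_cast hm
  refine Real.sin_pos_of_pos_of_lt_pi (by positivity) ?_
  rw [div_lt_iff₀ (by linarith)]
  nlinarith [Real.pi_pos]

theorem innovationSpectralDensity_nonneg {θ : ℝ} (hθ : 0 < θ) {m : ℕ} (hm : 2 ≤ m) (r : ℝ) {y : ℝ}
    (hy : 0 < y) : 0 ≤ innovationSpectralDensity θ m r y := by
  unfold innovationSpectralDensity
  have hs := sin_pi_div_pos hm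
  have h1 : (y ^ (1 / (m : ℝ))) ^ 2 - 2 * r * y ^ (1 / (m : ℝ)) * Real.cos (Real.pi / m) + r ^ 2
      = (r - y ^ (1 / (m : ℝ)) * Real.cos (Real.pi / m)) ^ 2
        + (y ^ (1 / (m : ℝ)) * Real.sin (Real.pi / m)) ^ 2 := by
    linear_combination (-(y ^ (1 / (m : ℝ))) ^ 2) * (Real.sin_sq_add_cos_sq (Real.pi / m))
  rw [h1]
  positivity

/-- The Stieltjes transform of the spectral density at `q ^ m`. The term subtracted for `0 < r` comes
from the pole at `r ^ m`. -/
theorem stieltjes_innovationSpectralDensity {θ : ℝ} (hθ : 0 < θ) {m : ℕ} (hm : 2 ≤ m) {q r : ℝ}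
    (hrq : |r| < q) :
    IntegrableOn (fun y => innovationSpectralDensity θ m r y / (y + q ^ m)) (Ioi 0) ∧
    ∫ y in Ioi (0 : ℝ), innovationSpectralDensity θ m r y / (y + q ^ m) =
      Real.pi / θ * (1 / (q - r) - if 0 < r then m * r ^ (m - 1) / (q ^ m - r ^ m) else 0) := by
  have hm0 : (0 : ℝ) < m := by positivity
  have hq : 0 < q := (abs_nonneg r).trans_lt hrq
  obtain ⟨hint, hval⟩ := integral_sector hm hrq
  have hcongr : ∀ t ∈ Ioi (0 : ℝ), (|(m : ℝ)| * t ^ ((m : ℝ) - 1)) •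
      (innovationSpectralDensity θ m r (t ^ (m : ℝ)) / (t ^ (m : ℝ) + q ^ m)) =
      1 / θ * (m * t ^ m * Real.sin (Real.pi / m) /
      ((t ^ 2 - 2 * r * t * Real.cos (Real.pi / m) + r ^ 2) * (t ^ m + q ^ m))) := by
    intro t ht
    rw [mem_Ioi] at ht
    unfold innovationSpectralDensity
    rw [← Real.rpow_mul ht.le, mul_one_div_cancel hm0.ne', Real.rpow_one, Real.rpow_natCast,
      abs_of_pos hm0, Real.rpow_sub_one ht.ne', Real.rpow_natCast, smul_eq_mul]
    generalize t ^ 2 - 2 * r * t * Real.cos (Real.pi / m) + r ^ 2 = D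
    have : t ^ m + q ^ m ≠ 0 := by positivity
    rcases eq_or_ne D 0 with rfl | hD
    · simp
    field_simp
  constructor
  · rw [← integrableOn_Ioi_comp_rpow_iff _ hm0.ne']
    exact (integrableOn_congr_fun hcongr measurableSet_Ioi).2 (hint.const_mul _)
  · rw [← integral_comp_rpow_Ioi _ hm0.ne', setIntegral_congr_fun measurableSet_Ioi hcongr,
      integral_const_mul, hval]
    split_ifs <;> ring

theorem integrableOn_innovationIntegrand {θ : ℝ} (hθ : 0 < θ) {m : ℕ} (hm : 2 ≤ m) {l : ℝ}
    (hl : 0 < l) {x : ℝ} (hx : 0 < x) :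
    IntegrableOn (fun y => innovationIntegrand θ (1 / (m : ℝ)) l x y) (Ioi 0) := by
  set r := l ^ (1 / (m : ℝ)) - 1 / θ with hr
  set q := |r| + 1 with hq
  have hq0 : 0 < q := by positivity
  have h := (stieltjes_innovationSpectralDensity hθ hm (lt_add_one |r|)).1
  rw [← hq] at h
  -- the factor `(y + q ^ m) exp (-(x (y + l)))` is bounded, because `x y ≤ exp (x y)`
  have h1 := h.bdd_mul (c := 1 / x + q ^ m)
    (f := fun y => (y + q ^ m) * Real.exp (-(x * (y + l)))) (by fun_prop) ?_
  · refine (integrableOn_congr_fun (fun y hy => ?_) measurableSet_Ioi).2 h1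
    rw [mem_Ioi] at hy
    rw [innovationIntegrand_eq hθ m hl x hy, ← hr]
    have : y + q ^ m ≠ 0 := by positivity
    field_simp
  · filter_upwards [ae_restrict_mem measurableSet_Ioi] with y hy
    rw [mem_Ioi] at hy
    rw [Real.norm_eq_abs, abs_of_nonneg (by positivity), add_mul]
    have h2 : Real.exp (-(x * (y + l))) ≤ Real.exp (-(x * y)) :=
      Real.exp_le_exp.2 (by nlinarith [mul_pos hx hl])
    have h3 : x * y * Real.exp (-(x * y)) ≤ 1 := by
      have h4 : x * y ≤ Real.exp (x * y) := by linarith [Real.add_one_le_exp (x * y)]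
      calc x * y * Real.exp (-(x * y)) ≤ Real.exp (x * y) * Real.exp (-(x * y)) := by gcongr
        _ = 1 := by rw [← Real.exp_add]; simp
    have h5 : y * Real.exp (-(x * (y + l))) ≤ 1 / x := by
      rw [le_div_iff₀ hx]
      calc _ = x * y * Real.exp (-(x * (y + l))) := by ring
        _ ≤ x * y * Real.exp (-(x * y)) := by gcongr
        _ ≤ 1 := h3
    have h6 : Real.exp (-(x * (y + l))) ≤ 1 := Real.exp_le_one_iff.2 (by
      have := mul_pos hx (add_pos hy hl); linarith)
    have h7 : q ^ m * Real.exp (-(x * (y + l))) ≤ q ^ m :=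
      mul_le_of_le_one_right (by positivity) h6
    exact add_le_add h5 h7

theorem innovationResidue_eq {θ : ℝ} (hθ : 0 < θ) {m : ℕ} (hm : 2 ≤ m) {l : ℝ} (hl : 0 < l)
    {r : ℝ} (hr : r = l ^ (1 / (m : ℝ)) - 1 / θ) (x : ℝ) :
    innovationResidue θ m l x =
      (if 0 < r then m * r ^ (m - 1) / θ else 0) * Real.exp (-((l - r ^ m) * x)) := by
  have hm0 : (0 : ℝ) < m := by positivity
  -- the location of the pole is `r ^ m`, and it counts only if `r` is positive
  have hiff : 1 / θ ^ m < l ↔ 0 < r := by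
    rw [hr, sub_pos, one_div (m : ℝ), Real.lt_rpow_inv_iff_of_pos (by positivity) hl.le hm0,
      Real.rpow_natCast, one_div_pow]
  unfold innovationResidue innovationPole
  rw [← hr]
  simp only [hiff]
  split_ifs with h
  · have h1 : (r ^ m) ^ (1 / (m : ℝ) - 1) = (r ^ (m - 1))⁻¹ := by
      rw [Real.rpow_sub (by positivity), Real.rpow_one, ← Real.rpow_natCast, ← Real.rpow_mul h.le,
        mul_one_div_cancel hm0.ne', Real.rpow_one, Real.rpow_natCast,
        ← Nat.sub_add_cancel (by omega : 1 ≤ m), pow_succ]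
      simp
      field_simp
    rw [h1, show (r ^ m - l) * x = -((l - r ^ m) * x) by ring]
    field_simp
  · simp

theorem innovationDensity_terms_nonneg {θ : ℝ} (hθ : 0 < θ) {m : ℕ} (hm : 2 ≤ m) {l : ℝ}
    (hl : 0 < l) (x : ℝ) : 0 ≤ innovationResidue θ m l x ∧
      0 ≤ ∫ y in Ioi (0 : ℝ), innovationIntegrand θ (1 / (m : ℝ)) l x y := by
  constructor
  · rw [innovationResidue_eq hθ hm hl rfl]
    split_ifs
    · positivity
    · simp
  · refine setIntegral_nonneg measurableSet_Ioi fun y hy => ?_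
    rw [innovationIntegrand_eq hθ m hl x hy]
    exact mul_nonneg (innovationSpectralDensity_nonneg hθ hm _ hy) (Real.exp_pos _).le

theorem measurable_innovationDensity (θ : ℝ) (m : ℕ) (l : ℝ) :
    Measurable (innovationDensity θ m l) := by
  unfold innovationDensity
  refine Measurable.add ?_ (Measurable.const_mul ?_ _)
  · unfold innovationResidue; split_ifs <;> fun_prop
  · have : Measurable (fun p : ℝ × ℝ => innovationIntegrand θ (1 / (m : ℝ)) l p.1 p.2) := by
      unfold innovationIntegrand
      fun_prop
    exact this.stronglyMeasurable.integral_prod_right.measurable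

theorem lintegral_exp_neg_mul_Ioi {a : ℝ} (ha : 0 < a) :
    ∫⁻ x in Ioi (0 : ℝ), ENNReal.ofReal (Real.exp (-(a * x))) = ENNReal.ofReal (1 / a) := by
  have h := integral_exp_mul_Ioi (a := -a) (by linarith) 0
  simp only [neg_mul] at h
  rw [← ofReal_integral_eq_lintegral_ofReal, h]
  · simp [neg_div_neg_eq]
  · have h1 := integrableOn_exp_mul_Ioi (a := -a) (by linarith) 0
    simp only [neg_mul] at h1
    exact h1
  · exact ae_of_all _ fun x => (Real.exp_pos _).le

/-- For large `s` the Laplace transform of the density is that of the geometric tempered stable law: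
the pole of the Stieltjes transform cancels against the residue. -/
theorem lintegral_exp_mul_innovationDensity {θ : ℝ} (hθ : 0 < θ) {m : ℕ} (hm : 2 ≤ m) {l : ℝ}
    (hl : 0 < l) {s : ℝ} (hs : 0 ≤ s)
    (hsl : |l ^ (1 / (m : ℝ)) - 1 / θ| < (s + l) ^ (1 / (m : ℝ))) :
    ∫⁻ x in Ioi (0 : ℝ), ENNReal.ofReal (Real.exp (-(s * x))) *
      ENNReal.ofReal (innovationDensity θ m l x) =
    ENNReal.ofReal (1 / (1 + θ * ((s + l) ^ (1 / (m : ℝ)) - l ^ (1 / (m : ℝ))))) := by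
  have hm0 : (0 : ℝ) < m := by positivity
  set r := l ^ (1 / (m : ℝ)) - 1 / θ with hr
  set q := (s + l) ^ (1 / (m : ℝ)) with hq
  have hqm : q ^ m = s + l := by
    rw [hq, ← Real.rpow_natCast, ← Real.rpow_mul (by positivity), one_div_mul_cancel hm0.ne',
      Real.rpow_one]
  have hrm : r ^ m < q ^ m :=
    (le_abs_self _).trans_lt (by rw [abs_pow]; exact pow_lt_pow_left₀ hsl (abs_nonneg r) (by omega))
  have hqr : 0 < q - r := by linarith [le_abs_self r]
  obtain ⟨hKint, hKval⟩ := stieltjes_innovationSpectralDensity hθ hm hsl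
  set K := innovationSpectralDensity θ m r with hK
  have hKm : Measurable K := measurable_innovationSpectralDensity θ m r
  set C : ℝ := if 0 < r then m * r ^ (m - 1) / θ else 0 with hC
  have hC0 : 0 ≤ C := by rw [hC]; split_ifs <;> positivity
  have hsplit : ∀ x ∈ Ioi (0 : ℝ), ENNReal.ofReal (Real.exp (-(s * x))) *
      ENNReal.ofReal (innovationDensity θ m l x) =
      ENNReal.ofReal C * ENNReal.ofReal (Real.exp (-((q ^ m - r ^ m) * x))) +
      ENNReal.ofReal (1 / Real.pi) * ∫⁻ y in Ioi (0 : ℝ), ENNReal.ofReal (K y) *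
        ENNReal.ofReal (Real.exp (-((y + q ^ m) * x))) := by
    intro x hx
    rw [mem_Ioi] at hx
    obtain ⟨h1, h2⟩ := innovationDensity_terms_nonneg hθ hm hl x
    rw [innovationDensity, ENNReal.ofReal_add h1 (by positivity), mul_add]
    congr 1
    · rw [innovationResidue_eq hθ hm hl hr, ← ENNReal.ofReal_mul (Real.exp_pos _).le,
        ← ENNReal.ofReal_mul hC0, mul_left_comm, ← Real.exp_add, hqm]
      congr 3; ring
    · rw [ENNReal.ofReal_mul (by positivity), mul_left_comm]
      congr 1
      rw [ofReal_integral_eq_lintegral_ofReal (integrableOn_innovationIntegrand hθ hm hl hx),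
        ← lintegral_const_mul']
      · refine setLIntegral_congr_fun measurableSet_Ioi fun y hy => ?_
        rw [← ENNReal.ofReal_mul (Real.exp_pos _).le, innovationIntegrand_eq hθ m hl x hy,
          ← ENNReal.ofReal_mul (innovationSpectralDensity_nonneg hθ hm _ hy), mul_left_comm,
          ← Real.exp_add, hqm]
        congr 3; ring
      · exact ENNReal.ofReal_ne_top
      · filter_upwards [ae_restrict_mem measurableSet_Ioi] with y hy
        rw [innovationIntegrand_eq hθ m hl x hy]
        exact mul_nonneg (innovationSpectralDensity_nonneg hθ hm _ hy) (Real.exp_pos _).le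
  rw [setLIntegral_congr_fun measurableSet_Ioi hsplit, lintegral_add_left (by fun_prop),
    lintegral_const_mul _ (by fun_prop), lintegral_exp_neg_mul_Ioi (by linarith),
    lintegral_const_mul' _ _ ENNReal.ofReal_ne_top,
    lintegral_lintegral_swap (by fun_prop)]
  have hinner : ∀ y ∈ Ioi (0 : ℝ), ∫⁻ x in Ioi (0 : ℝ), ENNReal.ofReal (K y) *
      ENNReal.ofReal (Real.exp (-((y + q ^ m) * x))) = ENNReal.ofReal (K y / (y + q ^ m)) := by
    intro y hy
    rw [mem_Ioi] at hy
    rw [lintegral_const_mul _ (by fun_prop), lintegral_exp_neg_mul_Ioi (by rw [hqm]; linarith),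
      ← ENNReal.ofReal_mul (innovationSpectralDensity_nonneg hθ hm _ hy), mul_one_div]
  have hKnn : 0 ≤ᵐ[volume.restrict (Ioi 0)] fun y => K y / (y + q ^ m) := by
    filter_upwards [ae_restrict_mem measurableSet_Ioi] with y hy
    rw [mem_Ioi] at hy
    exact div_nonneg (innovationSpectralDensity_nonneg hθ hm _ hy) (by rw [hqm]; linarith)
  rw [setLIntegral_congr_fun measurableSet_Ioi hinner,
    ← ofReal_integral_eq_lintegral_ofReal hKint hKnn, ← ENNReal.ofReal_mul hC0,
    ← ENNReal.ofReal_mul (by positivity), ← ENNReal.ofReal_add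
      (mul_nonneg hC0 (one_div_nonneg.2 (by linarith)))
      (mul_nonneg (by positivity) (integral_nonneg_of_ae hKnn)), hKval]
  congr 1
  have h1 : 1 + θ * (q - l ^ (1 / (m : ℝ))) = θ * (q - r) := by
    rw [hr]; field_simp; ring
  rw [h1, hC]
  have h2 : q ^ m - r ^ m ≠ 0 := by linarith
  have h3 := hqr.ne'
  have h4 := Real.pi_ne_zero
  split_ifs
  · field_simp
    ring
  · field_simp
    ring

/-! ### Uniqueness of Laplace transforms -/

/-- Uniqueness in the Hausdorff moment problem: polynomials separate the points of the interval. -/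
theorem ext_of_moments_unitInterval {P P' : Measure unitInterval} [IsFiniteMeasure P]
    [IsFiniteMeasure P'] (h : ∀ n : ℕ, ∫ u, (u : ℝ) ^ n ∂P = ∫ u, (u : ℝ) ^ n ∂P') : P = P' := by
  let A : StarSubalgebra ℝ (BoundedContinuousFunction unitInterval ℝ) :=
    { carrier := {f | ∃ p : Polynomial ℝ, ∀ u, f u = p.eval (u : ℝ)}
      mul_mem' := by
        rintro f g ⟨p, hp⟩ ⟨p', hp'⟩
        exact ⟨p * p', fun u => by simp [hp, hp']⟩
      add_mem' := by
        rintro f g ⟨p, hp⟩ ⟨p', hp'⟩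
        exact ⟨p + p', fun u => by simp [hp, hp']⟩
      algebraMap_mem' := fun c => ⟨Polynomial.C c, fun u => by simp [Algebra.algebraMap_eq_smul_one]⟩
      star_mem' := by
        rintro f ⟨p, hp⟩
        exact ⟨p, fun u => by simp [hp]⟩ }
  refine ext_of_forall_mem_subalgebra_integral_eq_of_polish (A := A) ?_ ?_
  · intro x y hxy
    let f : BoundedContinuousFunction unitInterval ℝ :=
      BoundedContinuousFunction.mkOfCompact ⟨fun u => (u : ℝ), by fun_prop⟩
    refine ⟨f, ⟨BoundedContinuousFunction.toContinuousMapStarₐ ℝ f,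
      ⟨f, ⟨Polynomial.X, fun u => by simp [f]⟩, rfl⟩, rfl⟩, ?_⟩
    simpa [f] using fun h => hxy (Subtype.ext h)
  · rintro g ⟨p, hp⟩
    simp only [hp, Polynomial.eval_eq_sum_range]
    have hint : ∀ (Q : Measure unitInterval) [IsFiniteMeasure Q] (i : ℕ),
        Integrable (fun u : unitInterval => p.coeff i * (u : ℝ) ^ i) Q := fun Q _ i =>
      (Continuous.integrable_of_hasCompactSupport (by fun_prop)
        (HasCompactSupport.of_compactSpace _)).const_mul _
    rw [integral_finsetSum _ fun i _ => hint P i, integral_finsetSum _ fun i _ => hint P' i]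
    simp only [integral_const_mul, h]

/-- A measure on `(0, ∞)` is determined by its Laplace transform on a half-line `[S, ∞)` on which it
is finite. The measure itself need not be assumed finite. -/
theorem ext_of_lintegral_exp_neg {ν ν' : Measure ℝ} (hν : ν (Iic 0) = 0) (hν' : ν' (Iic 0) = 0)
    {S : ℝ} (hfin : ∫⁻ x, ENNReal.ofReal (Real.exp (-(S * x))) ∂ν ≠ ⊤)
    (h : ∀ s, S ≤ s → ∫⁻ x, ENNReal.ofReal (Real.exp (-(s * x))) ∂ν =
      ∫⁻ x, ENNReal.ofReal (Real.exp (-(s * x))) ∂ν') : ν = ν' := by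
  -- the tilt by `w` makes the measures finite, and `F` carries them to the unit interval; both
  -- operations can be undone
  set w : ℝ → ENNReal := fun x => ENNReal.ofReal (Real.exp (-(S * x))) with hw
  have hwm : Measurable w := by fun_prop
  let F : ℝ → unitInterval := fun x =>
    ⟨Real.exp (-(max x 0)), (Real.exp_pos _).le, Real.exp_le_one_iff.2 (by simp)⟩
  have hF : Measurable F := Measurable.subtype_mk (by fun_prop)
  have huntilt : ∀ κ : Measure ℝ, (κ.withDensity w).withDensity
      (fun x => ENNReal.ofReal (Real.exp (S * x))) = κ := by
    intro κ
    rw [← withDensity_mul _ hwm (by fun_prop)]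
    have : (w * fun x => ENNReal.ofReal (Real.exp (S * x))) = 1 := by
      funext x
      simp only [hw, Pi.mul_apply, Pi.one_apply]
      rw [← ENNReal.ofReal_mul (Real.exp_pos _).le, ← Real.exp_add]
      simp
    rw [this, withDensity_one]
  have hback : ∀ κ : Measure ℝ, κ (Iic 0) = 0 →
      ((κ.withDensity w).map F).map (fun u : unitInterval => -Real.log (u : ℝ)) =
        κ.withDensity w := by
    intro κ hκ
    rw [Measure.map_map (by fun_prop) hF]
    conv_rhs => rw [← Measure.map_id (μ := κ.withDensity w)]
    refine Measure.map_congr ((withDensity_absolutelyContinuous κ w).ae_le ?_)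
    have hκ' : ∀ᵐ x ∂κ, x ∉ Iic (0 : ℝ) := measure_eq_zero_iff_ae_notMem.1 hκ
    filter_upwards [hκ'] with x hx
    simp only [mem_Iic, not_le] at hx
    simp [F, hx.le]
  have hmoment : ∀ κ : Measure ℝ, κ (Iic 0) = 0 → ∀ n : ℕ,
      ∫ u, (u : ℝ) ^ n ∂((κ.withDensity w).map F) =
        (∫⁻ x, ENNReal.ofReal (Real.exp (-((S + n) * x))) ∂κ).toReal := by
    intro κ hκ n
    rw [integral_eq_lintegral_of_nonneg_ae (ae_of_all _ fun u => pow_nonneg u.2.1 n)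
      (by fun_prop), lintegral_map (by fun_prop) hF,
      lintegral_withDensity_eq_lintegral_mul _ hwm (by fun_prop)]
    congr 1
    have hκ' : ∀ᵐ x ∂κ, x ∉ Iic (0 : ℝ) := measure_eq_zero_iff_ae_notMem.1 hκ
    refine lintegral_congr_ae ?_
    filter_upwards [hκ'] with x hx
    simp only [mem_Iic, not_le] at hx
    simp only [hw, Pi.mul_apply, F, max_eq_left hx.le]
    rw [← ENNReal.ofReal_mul (Real.exp_pos _).le, ← Real.exp_nat_mul, ← Real.exp_add]
    congr 2; ring
  have hfinite : ∀ κ : Measure ℝ, ∫⁻ x, w x ∂κ ≠ ⊤ → IsFiniteMeasure (κ.withDensity w) :=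
    fun κ hκ => isFiniteMeasure_withDensity hκ
  have := hfinite ν hfin
  have := hfinite ν' (by rw [← h S le_rfl]; exact hfin)
  have hmap : (ν.withDensity w).map F = (ν'.withDensity w).map F := by
    refine ext_of_moments_unitInterval fun n => ?_
    rw [hmoment ν hν, hmoment ν' hν', h _ (by simp)]
  rw [← huntilt ν, ← hback ν hν, hmap, hback ν' hν', huntilt]

/-! ### The law of the innovations -/

theorem IsGeometricTemperedStable.lintegral_eq {ν : Measure ℝ} [IsProbabilityMeasure ν]
    {c β l : ℝ} (h : IsGeometricTemperedStable ν c β l) {s : ℝ} (hs : 0 ≤ s) :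
    ∫⁻ x, ENNReal.ofReal (Real.exp (-(s * x))) ∂ν =
      ENNReal.ofReal (1 / (1 + c * ((s + l) ^ β - l ^ β))) := by
  have hpos : ∀ᵐ x ∂ν, x ∉ Iic (0 : ℝ) := measure_eq_zero_iff_ae_notMem.1 h.1
  rw [← h.2 s hs, ofReal_integral_eq_lintegral_ofReal]
  · refine Integrable.of_bound (C := 1) (by fun_prop) ?_
    filter_upwards [hpos] with x hx
    simp only [mem_Iic, not_le] at hx
    rw [Real.norm_eq_abs, Real.abs_exp, Real.exp_le_one_iff, neg_nonpos]
    positivity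
  · exact ae_of_all _ fun x => (Real.exp_pos _).le

namespace IsStationaryAR

variable {Ω : Type*} [MeasurableSpace Ω] {μ : Measure Ω} {θ : ℝ} {Y I ε : ℕ → Ω → ℝ}

theorem ae_switch [IsProbabilityMeasure μ] (h : IsStationaryAR μ θ Y I ε) (n : ℕ) :
    ∀ᵐ ω ∂μ, I (n + 1) ω = 0 ∨ I (n + 1) ω = 1 := by
  have hm : ∀ a : ℝ, MeasurableSet {ω | I (n + 1) ω = a} := fun a =>
    h.measurable_I n (measurableSet_singleton a)
  have h1 : μ.real ({ω | I (n + 1) ω = 0} ∪ {ω | I (n + 1) ω = 1}) = 1 := by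
    rw [measureReal_union _ (hm 1), h.prob_zero, h.prob_one]
    · ring
    · exact Set.disjoint_left.2 fun ω h0 h1 => by
        simp only [mem_ofPred_eq] at h0 h1; rw [h0] at h1; norm_num at h1
  have h2 : μ ({ω | I (n + 1) ω = 0} ∪ {ω | I (n + 1) ω = 1}) = 1 := by
    rw [← ofReal_measureReal, h1, ENNReal.ofReal_one]
  exact (mem_ae_iff_prob_eq_one ((hm 0).union (hm 1))).2 h2

/-- On the event that the switching variable vanishes, which is independent of the innovation and has
positive probability, the innovation is a marginal of the process. -/
theorem innovation_pos [IsProbabilityMeasure μ] (h : IsStationaryAR μ θ Y I ε) (hθ : 0 < θ) (n : ℕ)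
    (hY : μ.map (Y (n + 1)) (Iic 0) = 0) : μ.map (ε (n + 1)) (Iic 0) = 0 := by
  rw [Measure.map_apply (h.measurable_Y _) measurableSet_Iic] at hY
  rw [Measure.map_apply (h.measurable_ε n) measurableSet_Iic]
  have h1 := (h.indep_switch n).measure_inter_preimage_eq_mul {0} (Iic 0)
    (measurableSet_singleton 0) measurableSet_Iic
  have h2 : μ (I (n + 1) ⁻¹' {0} ∩ ε (n + 1) ⁻¹' Iic 0) = 0 := by
    refine measure_mono_null_ae ?_ hY
    filter_upwards [h.recurrence n] with ω hω
    rintro ⟨h0, h3⟩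
    simp only [mem_preimage, mem_singleton_iff, mem_Iic] at h0 h3
    change Y (n + 1) ω ≤ 0
    rw [hω, h0]; simpa using h3
  rw [h2, eq_comm, mul_eq_zero] at h1
  refine h1.resolve_left fun h0 => hθ.ne' ?_
  rw [← h.prob_zero n]
  exact (measureReal_eq_zero_iff).2 h0

/-- `φ_Y = θ φ_ε + (1 - θ) φ_ε φ_Y` for the Laplace transforms of marginals and innovations. The
lower Lebesgue integral avoids any integrability assumption. -/
theorem lintegral_exp_recurrence [IsProbabilityMeasure μ] (h : IsStationaryAR μ θ Y I ε) (n : ℕ)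
    (s : ℝ) :
    ∫⁻ ω, ENNReal.ofReal (Real.exp (-(s * Y (n + 1) ω))) ∂μ =
      ENNReal.ofReal θ * ∫⁻ ω, ENNReal.ofReal (Real.exp (-(s * ε (n + 1) ω))) ∂μ +
      ENNReal.ofReal (1 - θ) * (∫⁻ ω, ENNReal.ofReal (Real.exp (-(s * ε (n + 1) ω))) ∂μ) *
        ∫⁻ ω, ENNReal.ofReal (Real.exp (-(s * Y n ω))) ∂μ := by
  let E : ℝ → ENNReal := fun x => ENNReal.ofReal (Real.exp (-(s * x)))
  have hE : Measurable E := by fun_prop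
  -- `δ a` is the indicator function of the point `a`
  let δ : ℝ → ℝ → ENNReal := fun a => ({a} : Set ℝ).indicator 1
  have hδ : ∀ a, Measurable (δ a) := fun a =>
    measurable_one.indicator (measurableSet_singleton a)
  have hIm := h.measurable_I n
  have hεm := h.measurable_ε n
  have hYm := h.measurable_Y n
  have hprob : ∀ a : ℝ, ∫⁻ ω, δ a (I (n + 1) ω) ∂μ = μ {ω | I (n + 1) ω = a} := by
    intro a
    exact lintegral_indicator_one (hIm (measurableSet_singleton a))
  have hsplit : ∀ a : ℝ, ∫⁻ ω, δ a (I (n + 1) ω) * E (ε (n + 1) ω) ∂μ =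
      μ {ω | I (n + 1) ω = a} * ∫⁻ ω, E (ε (n + 1) ω) ∂μ := by
    intro a
    rw [← hprob a]
    exact lintegral_mul_eq_lintegral_mul_lintegral_of_indepFun ((hδ a).comp hIm) (hE.comp hεm)
      ((h.indep_switch n).comp (hδ a) hE)
  have hpast : ∫⁻ ω, (δ 1 (I (n + 1) ω) * E (ε (n + 1) ω)) * E (Y n ω) ∂μ =
      (∫⁻ ω, δ 1 (I (n + 1) ω) * E (ε (n + 1) ω) ∂μ) * ∫⁻ ω, E (Y n ω) ∂μ := by
    have h1 := (h.indep_past n).comp (φ := fun p : ℝ × ℝ => δ 1 p.1 * E p.2)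
      (ψ := fun y : Fin (n + 1) → ℝ => E (y (Fin.last n)))
      (((hδ 1).comp measurable_fst).mul (hE.comp measurable_snd))
      (hE.comp (measurable_pi_apply _))
    have h2 := lintegral_mul_eq_lintegral_mul_lintegral_of_indepFun
      (f := fun ω => δ 1 (I (n + 1) ω) * E (ε (n + 1) ω)) (g := fun ω => E (Y n ω))
      (((hδ 1).comp hIm).mul (hE.comp hεm)) (hE.comp hYm) (by simpa [Function.comp_def] using h1)
    exact h2
  have hθ : μ {ω | I (n + 1) ω = 0} = ENNReal.ofReal θ := by
    rw [← h.prob_zero n, ofReal_measureReal]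
  have hθ' : μ {ω | I (n + 1) ω = 1} = ENNReal.ofReal (1 - θ) := by
    rw [← h.prob_one n, ofReal_measureReal]
  have hae : ∀ᵐ ω ∂μ, E (Y (n + 1) ω) = δ 0 (I (n + 1) ω) * E (ε (n + 1) ω) +
      (δ 1 (I (n + 1) ω) * E (ε (n + 1) ω)) * E (Y n ω) := by
    filter_upwards [h.recurrence n, h.ae_switch n] with ω hω hI
    rw [hω]
    rcases hI with hI | hI
    · simp [hI, δ]
    · simp only [hI, δ, E]
      rw [Set.indicator_of_notMem (by simp), Set.indicator_of_mem (by simp), zero_mul, zero_add,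
        Pi.one_apply, one_mul, one_mul, ← ENNReal.ofReal_mul (Real.exp_pos _).le, ← Real.exp_add]
      congr 2; ring
  have hm0 : Measurable fun ω => δ 0 (I (n + 1) ω) * E (ε (n + 1) ω) :=
    ((hδ 0).comp hIm).mul (hE.comp hεm)
  rw [lintegral_congr_ae hae, lintegral_add_left hm0, hpast, hsplit, hsplit, hθ, hθ']

theorem isGeometricTemperedStable_innovation [IsProbabilityMeasure μ]
    (h : IsStationaryAR μ θ Y I ε) (hθ0 : 0 < θ) (hθ1 : θ < 1) {β l : ℝ} (hβ : 0 ≤ β) (hl : 0 ≤ l)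
    (hY : ∀ n, IsGeometricTemperedStable (μ.map (Y n)) 1 β l) (n : ℕ) :
    IsGeometricTemperedStable (μ.map (ε (n + 1))) θ β l := by
  refine ⟨h.innovation_pos hθ0 n (hY (n + 1)).1, fun s hs => ?_⟩
  have hψ : 0 ≤ (s + l) ^ β - l ^ β :=
    sub_nonneg.2 (Real.rpow_le_rpow hl (by linarith) hβ)
  have hYl : ∀ k, ∫⁻ ω, ENNReal.ofReal (Real.exp (-(s * Y k ω))) ∂μ =
      ENNReal.ofReal (1 / (1 + ((s + l) ^ β - l ^ β))) := by
    intro k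
    have := Measure.isProbabilityMeasure_map (μ := μ) (h.measurable_Y k).aemeasurable
    have h1 := (hY k).lintegral_eq hs
    rwa [lintegral_map (by fun_prop) (h.measurable_Y k), one_mul] at h1
  have hrec := h.lintegral_exp_recurrence n s
  rw [hYl, hYl] at hrec
  rw [integral_eq_lintegral_of_nonneg_ae (ae_of_all _ fun x => (Real.exp_pos _).le)
    (by fun_prop), lintegral_map (by fun_prop) (h.measurable_ε n)]
  generalize ∫⁻ ω, ENNReal.ofReal (Real.exp (-(s * ε (n + 1) ω))) ∂μ = A at hrec ⊢
  generalize (s + l) ^ β - l ^ β = ψ at hrec hψ ⊢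
  -- the transform of the innovation is finite since `θ A` is at most that of the marginal
  have hA : A ≠ ⊤ := by
    rintro rfl
    rw [ENNReal.mul_top (by simpa using hθ0)] at hrec
    simp at hrec
  lift A to NNReal using hA
  have h2 := congrArg ENNReal.toReal hrec
  have h3 : 0 < 1 + ψ := by positivity
  rw [ENNReal.toReal_add (by finiteness) (by finiteness)] at h2
  simp only [ENNReal.toReal_mul, ENNReal.coe_toReal, ENNReal.toReal_ofReal hθ0.le,
    ENNReal.toReal_ofReal (sub_nonneg.2 hθ1.le),
    ENNReal.toReal_ofReal (one_div_nonneg.2 h3.le)] at h2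
  rw [ENNReal.coe_toReal, eq_div_iff (by positivity)]
  field_simp at h2
  linear_combination -h2

end IsStationaryAR

theorem mainTheorem3 {Ω : Type*} [MeasurableSpace Ω] (μ : Measure Ω) [IsProbabilityMeasure μ]
    (θ : ℝ) (hθ0 : 0 < θ) (hθ1 : θ < 1) (m : ℕ) (hm : 2 ≤ m) (l : ℝ) (hl : 0 < l)
    (Y I ε : ℕ → Ω → ℝ) (hAR : IsStationaryAR μ θ Y I ε)
    (hY : ∀ n, IsGeometricTemperedStable (μ.map (Y n)) 1 (1 / (m : ℝ)) l) :
    (∀ n, IsGeometricTemperedStable (μ.map (ε (n + 1))) θ (1 / (m : ℝ)) l) ∧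
    (∀ x : ℝ, 0 < x →
      IntegrableOn (fun y => innovationIntegrand θ (1 / (m : ℝ)) l x y) (Ioi 0) ∧
      0 ≤ innovationDensity θ m l x) ∧
    (∀ n, μ.map (ε (n + 1)) = (volume.restrict (Ioi (0 : ℝ))).withDensity
      (fun x => ENNReal.ofReal (innovationDensity θ m l x))) := by
  have hε := hAR.isGeometricTemperedStable_innovation hθ0 hθ1 (by positivity) hl.le hY
  refine ⟨hε, fun x hx => ⟨integrableOn_innovationIntegrand hθ0 hm hl hx, ?_⟩, fun n => ?_⟩
  · obtain ⟨h1, h2⟩ := innovationDensity_terms_nonneg hθ0 hm hl x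
    unfold innovationDensity
    positivity
  have := Measure.isProbabilityMeasure_map (μ := μ) (hAR.measurable_ε n).aemeasurable
  set r := l ^ (1 / (m : ℝ)) - 1 / θ with hr
  have hm0 : (0 : ℝ) < m := by positivity
  -- for `s ≥ (|r| + 1) ^ m` the formula for the Laplace transform of the density applies
  have hlarge : ∀ s, (|r| + 1) ^ m ≤ s → 0 ≤ s ∧ |r| < (s + l) ^ (1 / (m : ℝ)) := by
    intro s hs
    have hs0 : 0 ≤ s := le_trans (by positivity) hs
    refine ⟨hs0, ?_⟩
    rw [one_div, Real.lt_rpow_inv_iff_of_pos (abs_nonneg r) (by positivity) hm0, Real.rpow_natCast]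
    have : |r| ^ m ≤ (|r| + 1) ^ m := by gcongr; linarith
    linarith
  refine ext_of_lintegral_exp_neg (S := (|r| + 1) ^ m) (hε n).1 ?_ ?_ fun s hs => ?_
  · refine withDensity_absolutelyContinuous _ _ ?_
    rw [Measure.restrict_apply measurableSet_Iic, Iic_inter_Ioi, Ioc_self, measure_empty]
  · rw [(hε n).lintegral_eq (by positivity)]
    exact ENNReal.ofReal_ne_top
  · obtain ⟨hs0, hs1⟩ := hlarge s hs
    have hd := (measurable_innovationDensity θ m l).ennreal_ofReal
    rw [(hε n).lintegral_eq hs0, ← lintegral_exp_mul_innovationDensity hθ0 hm hl hs0 hs1,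
      lintegral_withDensity_eq_lintegral_mul _ hd (by fun_prop)]
    exact lintegral_congr fun x => mul_comm _ _
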